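/- On $\mathbb{C}^2$ write $D_j=\partial/\partial z_j$, $\bar D_j=\partial/\partial\bar z_j$ for the Wirtinger derivatives and, for multi-indices $\alpha,\beta\in\mathbb{N}^2$, $D^\beta=D_1^{\beta_1}D_2^{\beta_2}$, $\bar D^\alpha=\bar D_1^{\alpha_1}\bar D_2^{\alpha_2}$, $|\alpha|=\alpha_1+\alpha_2$. For integers $p,q\ge 0$ let $H_{p,q}(\mathbb{C}^2)$ be the complex vector space of polynomials in $z,\bar z$ on $\mathbb{C}^2$ that are homogeneous of bidegree $p,q$ (linear combinations of the $z^\alpha\bar z^\beta$ with $|\alpha|=p$, $|\beta|=q$) and harmonic ($\Delta f=0$ with $\Delta=4(D_1\bar D_1+D_2\bar D_2)$), and let $H_{p,q}(\mathbb{S}^3)$ be the space of their restrictions to the unit sphere $\mathbb{S}^3\subset\mathbb{C}^2$. Let $K$ be the Kelvin transform, $Kg(z)=|z|^{-2}g(z/|z|^2)$ for $z\neq 0$. **Theorem.** Let $p,q\ge 0$ be integers. The functions $$K[\bar D^\alpha D^\beta|z|^{-2}],\qquad |\alpha|=p,\ |\beta|=q,\ \alpha_1=0\text{ or }\beta_1=0,$$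 defined on $\mathbb{C}^2\setminus\{0\}$, extend to polynomials on $\mathbb{C}^2$, and (indexed by the pairs $(\alpha,\beta)$) these form a vector space basis of $H_{p,q}(\mathbb{C}^2)$. Their restrictions to $\mathbb{S}^3$ are the functions $\bar D^\alpha D^\beta|z|^{-2}$ with the same $\alpha,\beta$, and these form a basis of $H_{p,q}(\mathbb{S}^3)$ that is orthogonal with respect to the inner product $\langle f,g\rangle=\int_{\mathbb{S}^3}f\bar g\,d\sigma$ of $L^2(\mathbb{S}^3)$, where $\sigma$ is the surface area measure. -/

import Mathlib

open scoped ContDiff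

noncomputable section

namespace SphericalHarmonics

/-- Complex two-space `ℂ²` with its Euclidean (Hermitian) norm. -/
abbrev C2 : Type := EuclideanSpace ℂ (Fin 2)

/-- The unit sphere `𝕊³ ⊆ ℂ²`. -/
abbrev S3 : Set C2 := Metric.sphere (0 : C2) 1

/-- The standard surface area measure on `𝕊³`. -/
def sigma : MeasureTheory.Measure S3 :=
  (MeasureTheory.volume : MeasureTheory.Measure C2).toSphere

/-- The Wirtinger derivative `∂/∂z_j = (∂/∂x_j - i ∂/∂y_j) / 2`, where `z_j = x_j + i y_j`. -/
def dz (j : Fin 2) (f : C2 → ℂ) (z : C2) : ℂ :=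
  (1 / 2 : ℂ) * (fderiv ℝ f z (EuclideanSpace.single j 1)
    - Complex.I * fderiv ℝ f z (EuclideanSpace.single j Complex.I))

/-- The Wirtinger derivative `∂/∂z̄_j = (∂/∂x_j + i ∂/∂y_j) / 2`, where `z_j = x_j + i y_j`. -/
def dzbar (j : Fin 2) (f : C2 → ℂ) (z : C2) : ℂ :=
  (1 / 2 : ℂ) * (fderiv ℝ f z (EuclideanSpace.single j 1)
    + Complex.I * fderiv ℝ f z (EuclideanSpace.single j Complex.I))

/-- `D^β = (∂/∂z_1)^{β_1} (∂/∂z_2)^{β_2}`. -/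
def DPow (β : Fin 2 → ℕ) (f : C2 → ℂ) : C2 → ℂ :=
  (dz 0)^[β 0] ((dz 1)^[β 1] f)

/-- `D̄^α = (∂/∂z̄_1)^{α_1} (∂/∂z̄_2)^{α_2}`. -/
def DbarPow (α : Fin 2 → ℕ) (f : C2 → ℂ) : C2 → ℂ :=
  (dzbar 0)^[α 0] ((dzbar 1)^[α 1] f)

/-- The Laplacian `Δ = 4 (∂²/∂z_1∂z̄_1 + ∂²/∂z_2∂z̄_2)` on `ℂ²`. -/
def laplacian (f : C2 → ℂ) (z : C2) : ℂ :=
  4 * (dz 0 (dzbar 0 f) z + dz 1 (dzbar 1 f) z)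

/-- The Kelvin transform `K g (z) = |z|⁻² g (z / |z|²)` (meaningful for `z ≠ 0`). -/
def kelvin (g : C2 → ℂ) (z : C2) : ℂ :=
  (((‖z‖ ^ 2)⁻¹ : ℝ) : ℂ) * g ((‖z‖ ^ 2)⁻¹ • z)

/-- The function `|z|⁻²` (meaningful for `z ≠ 0`). -/
def invNormSq (z : C2) : ℂ := (((‖z‖ ^ 2)⁻¹ : ℝ) : ℂ)

/-- The monomial function `z^α z̄^β`. -/
def monomialFun (α β : Fin 2 → ℕ) (z : C2) : ℂ :=
  (∏ j, z j ^ α j) * ∏ j, (starRingEnd ℂ (z j)) ^ β j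

/-- `P_{p,q}(ℂ²)`: the polynomial functions on `ℂ²` that are homogeneous of bidegree `p, q`,
that is, of degree `p` in `z` and of degree `q` in `z̄`. -/
def Ppq (p q : ℕ) : Submodule ℂ (C2 → ℂ) :=
  Submodule.span ℂ {f | ∃ α β : Fin 2 → ℕ, ∑ j, α j = p ∧ ∑ j, β j = q ∧ f = monomialFun α β}

theorem contDiff_of_mem_Ppq {p q : ℕ} {f : C2 → ℂ} (hf : f ∈ Ppq p q) : ContDiff ℝ ∞ f := by
  unfold Ppq at hf
  induction hf using Submodule.span_induction with
  | mem f h =>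
    obtain ⟨α, β, -, -, rfl⟩ := h
    have hc (j : Fin 2) : ContDiff ℝ ∞ (fun z : C2 => z j) := by fun_prop
    have hcb (j : Fin 2) : ContDiff ℝ ∞ (fun z : C2 => (starRingEnd ℂ) (z j)) :=
      Complex.conjCLE.contDiff.comp (hc j)
    unfold monomialFun
    exact (contDiff_prod fun j _ => (hc j).pow _).mul (contDiff_prod fun j _ => (hcb j).pow _)
  | zero => exact contDiff_const
  | add f g _ _ hf hg => exact hf.add hg
  | smul c f _ hf => exact contDiff_const.smul hf

theorem contDiff_dzbar (j : Fin 2) {f : C2 → ℂ} (hf : ContDiff ℝ ∞ f) :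
    ContDiff ℝ ∞ (dzbar j f) := by
  have h (v : C2) : ContDiff ℝ ∞ (fun z => fderiv ℝ f z v) :=
    (hf.fderiv_right (m := ∞) (by simp)).clm_apply contDiff_const
  unfold dzbar
  exact contDiff_const.mul ((h _).add (contDiff_const.mul (h _)))

theorem dz_add (j : Fin 2) {f g : C2 → ℂ} (hf : Differentiable ℝ f) (hg : Differentiable ℝ g) :
    dz j (f + g) = dz j f + dz j g := by
  funext z
  simp only [dz, fderiv_add (hf z) (hg z), Pi.add_apply, add_apply]
  ring

theorem dzbar_add (j : Fin 2) {f g : C2 → ℂ} (hf : Differentiable ℝ f)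
    (hg : Differentiable ℝ g) : dzbar j (f + g) = dzbar j f + dzbar j g := by
  funext z
  simp only [dzbar, fderiv_add (hf z) (hg z), Pi.add_apply, add_apply]
  ring

theorem dz_smul (j : Fin 2) (c : ℂ) {f : C2 → ℂ} (hf : Differentiable ℝ f) :
    dz j (c • f) = c • dz j f := by
  funext z
  simp only [dz, fderiv_const_smul (hf z) c, Pi.smul_apply, smul_apply,
    smul_eq_mul]
  ring

theorem dzbar_smul (j : Fin 2) (c : ℂ) {f : C2 → ℂ} (hf : Differentiable ℝ f) :
    dzbar j (c • f) = c • dzbar j f := by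
  funext z
  simp only [dzbar, fderiv_const_smul (hf z) c, Pi.smul_apply, smul_apply,
    smul_eq_mul]
  ring

theorem laplacian_add {f g : C2 → ℂ} (hf : ContDiff ℝ ∞ f) (hg : ContDiff ℝ ∞ g) :
    laplacian (f + g) = laplacian f + laplacian g := by
  have d {h : C2 → ℂ} (hh : ContDiff ℝ ∞ h) : Differentiable ℝ h := hh.differentiable (by simp)
  funext z
  simp only [laplacian, Pi.add_apply, dzbar_add _ (d hf) (d hg),
    dz_add _ (d (contDiff_dzbar _ hf)) (d (contDiff_dzbar _ hg))]
  ring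

theorem laplacian_smul (c : ℂ) {f : C2 → ℂ} (hf : ContDiff ℝ ∞ f) :
    laplacian (c • f) = c • laplacian f := by
  have d {h : C2 → ℂ} (hh : ContDiff ℝ ∞ h) : Differentiable ℝ h := hh.differentiable (by simp)
  funext z
  simp only [laplacian, Pi.smul_apply, dzbar_smul _ c (d hf),
    dz_smul _ c (d (contDiff_dzbar _ hf)), smul_eq_mul]
  ring

/-- `H_{p,q}(ℂ²)`: the harmonic polynomials on `ℂ²` that are homogeneous of bidegree `p, q`. -/
def Hpq (p q : ℕ) : Submodule ℂ (C2 → ℂ) where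
  carrier := {f | f ∈ Ppq p q ∧ laplacian f = 0}
  zero_mem' := by
    refine ⟨Submodule.zero_mem _, ?_⟩
    have h := laplacian_smul 0 (f := (0 : C2 → ℂ)) contDiff_const
    simpa using h
  add_mem' := by
    rintro f g ⟨hf, hf'⟩ ⟨hg, hg'⟩
    refine ⟨Submodule.add_mem _ hf hg, ?_⟩
    rw [laplacian_add (contDiff_of_mem_Ppq hf) (contDiff_of_mem_Ppq hg), hf', hg', add_zero]
  smul_mem' := by
    rintro c f ⟨hf, hf'⟩
    refine ⟨Submodule.smul_mem _ c hf, ?_⟩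
    rw [laplacian_smul c (contDiff_of_mem_Ppq hf), hf', smul_zero]

/-- `H_{p,q}(𝕊³)`: the restrictions to `𝕊³` of the elements of `H_{p,q}(ℂ²)`. -/
def HpqS (p q : ℕ) : Submodule ℂ (S3 → ℂ) :=
  (Hpq p q).map (LinearMap.funLeft ℂ ℂ (Subtype.val : S3 → C2))

/-- The index set: pairs `(α, β)` of multi-indices with `|α| = p`, `|β| = q`, and
`α_1 = 0` or `β_1 = 0`. -/
def Index (p q : ℕ) : Type :=
  {ab : (Fin 2 → ℕ) × (Fin 2 → ℕ) //
    ∑ j, ab.1 j = p ∧ ∑ j, ab.2 j = q ∧ (ab.1 0 = 0 ∨ ab.2 0 = 0)}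

/-- The function `D̄^α D^β |z|⁻²` (meaningful for `z ≠ 0`) for the index `(α, β)`. -/
def derivInvNormSq {p q : ℕ} (i : Index p q) : C2 → ℂ :=
  DbarPow i.1.1 (DPow i.1.2 invNormSq)

end SphericalHarmonics

end

/-! Treat `z` and `z̄` as independent variables. Each derivative `∂_s` takes `P / |z|^(2n+2)` to `P'
/ |z|^(2n+4)` with an explicit numerator `P'` (`kelvinStep`), so `D̄^α D^β |z|⁻²` is a polynomial of
bidegree `(p, q)` over `|z|^(2(p+q)+2)`, and the Kelvin transform returns exactly this numerator.
Numerators stay harmonic by Euler's identity (`lapPoly_kelvinStep`), and have weight `α_1 - β_1`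
under rotation of `z_1`. They are nonzero because they do not vanish at a point of the complex null
cone (`eval_nullPoint_kelvinStep`).

The basis property needs no dimension count. A harmonic polynomial is determined by its coefficients
at monomials not divisible by `z_1 z̄_1` (`eq_zero_of_lapPoly_eq_zero`). In bidegree `(p, q)` these
monomials are indexed by `Index p q` and have distinct rotation weights, so each numerator contains
exactly one of them, its own. The matrix of determining coefficients is thus diagonal and
invertible.

Distinct weights also give orthogonality, as the surface measure is rotation invariant. Homogeneity
makes restriction to the sphere injective. -/

noncomputable section

namespace SphericalHarmonics

/-! ### Algebra of harmonic polynomials in four independent variables -/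

section

open MvPolynomial

/-- The variables `z_j` (left) and `z̄_j` (right) of polynomials in `z, z̄`. -/
abbrev Var : Type := Fin 2 ⊕ Fin 2

/-- Polynomials in independent variables `z_1, z_2, z̄_1, z̄_2`. -/
abbrev Poly : Type := MvPolynomial Var ℂ

/-- The polynomial `z_1 z̄_1 + z_2 z̄_2`. -/
def normSqPoly : Poly := ∑ j : Fin 2, X (Sum.inl j) * X (Sum.inr j)

/-- A quarter of the Laplacian on polynomials. -/
def lapPoly (P : Poly) : Poly := ∑ j : Fin 2, pderiv (Sum.inl j) (pderiv (Sum.inr j) P)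

theorem pderiv_comm (s t : Var) (P : Poly) : pderiv s (pderiv t P) = pderiv t (pderiv s P) := by
  ext m
  simp only [coeff_pderiv, Finsupp.add_apply, Finsupp.single_apply]
  rw [add_right_comm]
  by_cases h : s = t
  · subst h; rfl
  · simp [h, Ne.symm h]; ring

theorem pderiv_normSqPoly (s : Var) : pderiv s normSqPoly = X s.swap := by
  rcases s with j | j <;> fin_cases j <;> simp [normSqPoly, pderiv_X]

theorem lapPoly_add (P Q : Poly) : lapPoly (P + Q) = lapPoly P + lapPoly Q := by
  simp [lapPoly, Finset.sum_add_distrib]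

theorem lapPoly_smul (c : ℂ) (P : Poly) : lapPoly (c • P) = c • lapPoly P := by
  simp [lapPoly]

theorem lapPoly_pderiv (s : Var) (P : Poly) : lapPoly (pderiv s P) = pderiv s (lapPoly P) := by
  simp only [lapPoly, map_sum]
  refine Finset.sum_congr rfl fun j _ => ?_
  rw [pderiv_comm (Sum.inr j) s, pderiv_comm (Sum.inl j) s]

/-- With `lapPoly_normSqPoly_mul`, gives the commutators of `Δ/4` with a variable (a derivative) and
with `|z|²` (2 plus the Euler operator). -/
theorem lapPoly_X_mul (s : Var) (P : Poly) :
    lapPoly (X s.swap * P) = pderiv s P + X s.swap * lapPoly P := by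
  rcases s with j | j <;> fin_cases j <;>
    simp [lapPoly, pderiv_X, Pi.single_apply] <;> ring

theorem lapPoly_normSqPoly_mul (P : Poly) :
    lapPoly (normSqPoly * P) = 2 * P + ∑ s, X s * pderiv s P + normSqPoly * lapPoly P := by
  simp [lapPoly, pderiv_normSqPoly]
  ring

/-- The polynomial `P'` with `∂_s (P / |z|^(2n+2)) = P' / |z|^(2n+4)`. -/
def kelvinStep (s : Var) (n : ℕ) (P : Poly) : Poly :=
  normSqPoly * pderiv s P - C (n + 1 : ℂ) * (X s.swap * P)

theorem euler_pderiv {n : ℕ} {P : Poly} (hP : P.IsHomogeneous n) (s : Var) :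
    ∑ t, X t * pderiv t (pderiv s P) + pderiv s P = n • pderiv s P := by
  have h := congrArg (pderiv s) hP.sum_X_mul_pderiv
  rw [map_sum, map_nsmul] at h
  rw [← h]
  simp only [Derivation.leibniz, smul_eq_mul, pderiv_X, Finset.sum_add_distrib]
  rw [Finset.sum_eq_single s (f := fun t => pderiv t P * (Pi.single s 1 : Var → Poly) t)]
  · simp [pderiv_comm s]
  · intro b _ hb; simp [hb]
  · simp

/-- The commutators leave `2 ∂_s P + E ∂_s P - (n + 1) ∂_s P`, with `E` the Euler operator. This
vanishes since `E ∂_s P = (n - 1) ∂_s P`. -/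
theorem lapPoly_kelvinStep {n : ℕ} {P : Poly} (hP : P.IsHomogeneous n) (hl : lapPoly P = 0)
    (s : Var) : lapPoly (kelvinStep s n P) = 0 := by
  have h := euler_pderiv hP s
  have e : kelvinStep s n P =
      normSqPoly * pderiv s P + (-(n + 1 : ℂ)) • (X s.swap * P) := by
    rw [kelvinStep, neg_smul, ← sub_eq_add_neg, smul_eq_C_mul]
  rw [e, lapPoly_add, lapPoly_smul, lapPoly_normSqPoly_mul, lapPoly_X_mul, lapPoly_pderiv, hl,
    smul_eq_C_mul]
  simp only [nsmul_eq_mul] at h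
  simp only [map_neg, map_add, map_natCast, map_one, map_zero, mul_zero, add_zero]
  linear_combination h

/-- A harmonic polynomial is determined by the coefficients of the monomials which do not
involve both `z_1` and `z̄_1`. -/
theorem eq_zero_of_lapPoly_eq_zero {P : Poly} (hl : lapPoly P = 0)
    (h0 : ∀ m : Var →₀ ℕ, m (Sum.inl 0) = 0 ∨ m (Sum.inr 0) = 0 → coeff m P = 0) : P = 0 := by
  suffices h : ∀ k, ∀ m : Var →₀ ℕ, m (Sum.inl 0) = k → coeff m P = 0 by
    ext m; simpa using h _ m rfl
  intro k
  induction k with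
  | zero => exact fun m hm => h0 m (Or.inl hm)
  | succ k ih =>
    intro m hm
    by_cases hr : m (Sum.inr 0) = 0
    · exact h0 m (Or.inr hr)
    -- The coefficient of `lapPoly P` at `m' = m / (z_1 z̄_1)` relates the coefficient of `P` at `m`
    -- to the one at `m' z_2 z̄_2`, whose exponent of `z_1` is one lower.
    set m' : Var →₀ ℕ := m - Finsupp.single (Sum.inl 0) 1 - Finsupp.single (Sum.inr 0) 1 with hm'
    have e : m' + Finsupp.single (Sum.inl 0) 1 + Finsupp.single (Sum.inr 0) 1 = m := by
      ext s
      rcases s with j | j <;> fin_cases j <;> simp [hm'] <;> omega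
    have h := congrArg (coeff m') hl
    simp only [lapPoly, Fin.sum_univ_two, coeff_add, coeff_pderiv, coeff_zero, e] at h
    rw [ih (m' + _ + _) (by simp [hm', hm])] at h
    simp only [zero_mul, add_zero, mul_eq_zero] at h
    rcases h with (h | h) | h
    · exact h
    · exact absurd h (Nat.cast_add_one_ne_zero _)
    · exact absurd h (Nat.cast_add_one_ne_zero _)

/-- The weights recording the degree in `z`, the degree in `z̄` and the weight under rotation
of the first coordinate. -/
def wt : Var → ℤ × ℤ × ℤ :=
  Sum.elim ![(1, 0, 1), (1, 0, 0)] ![(0, 1, -1), (0, 1, 0)]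

theorem wt_add_wt_swap (s : Var) : wt s + wt s.swap = (1, 1, 0) := by
  rcases s with j | j <;> fin_cases j <;> simp [wt]

theorem weight_wt (m : Var →₀ ℕ) : Finsupp.weight wt m =
    ((m (Sum.inl 0) + m (Sum.inl 1) : ℤ), (m (Sum.inr 0) + m (Sum.inr 1) : ℤ),
      (m (Sum.inl 0) - m (Sum.inr 0) : ℤ)) := by
  rw [Finsupp.weight_apply, Finsupp.sum_fintype _ _ (by simp)]
  simp [wt, sub_eq_add_neg, Prod.ext_iff]

theorem isWeightedHomogeneous_normSqPoly : normSqPoly.IsWeightedHomogeneous wt (1, 1, 0) := by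
  refine IsWeightedHomogeneous.sum _ _ _ fun j _ => ?_
  rw [← wt_add_wt_swap (Sum.inl j)]
  exact (isWeightedHomogeneous_X _ _ _).mul (isWeightedHomogeneous_X _ _ _)

/-- Multiplying by `|z|²` and applying `∂_s` shifts the weight just as multiplying by the conjugate
variable does. -/
theorem isWeightedHomogeneous_kelvinStep {P : Poly} {w : ℤ × ℤ × ℤ}
    (hP : P.IsWeightedHomogeneous wt w) (s : Var) (n : ℕ) :
    (kelvinStep s n P).IsWeightedHomogeneous wt (w + wt s.swap) := by
  refine IsWeightedHomogeneous.sub ?_ (IsWeightedHomogeneous.C_mul ?_ _)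
  · have h : (pderiv s P).IsWeightedHomogeneous wt (w - wt s) := hP.pderiv (by abel)
    have e : w + wt s.swap = (1, 1, 0) + (w - wt s) := by rw [← wt_add_wt_swap s]; abel
    rw [e]
    exact isWeightedHomogeneous_normSqPoly.mul h
  · rw [add_comm]; exact (isWeightedHomogeneous_X _ _ _).mul hP

/-- A zero of `z_1 z̄_1 + z_2 z̄_2` at which no variable vanishes. -/
def nullPoint : Var → ℂ := Sum.elim ![1, 1] ![1, -1]

/-- On the null cone only the term `-(n + 1) X s.swap * P` survives, and no factor of it vanishes at
the chosen point. -/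
theorem eval_nullPoint_kelvinStep {P : Poly} (hP : eval nullPoint P ≠ 0) (s : Var) (n : ℕ) :
    eval nullPoint (kelvinStep s n P) ≠ 0 := by
  have h1 : eval nullPoint normSqPoly = 0 := by simp [normSqPoly, nullPoint]
  have h2 : nullPoint s.swap ≠ 0 := by
    rcases s with j | j <;> fin_cases j <;> simp [nullPoint]
  have h3 : (n + 1 : ℂ) ≠ 0 := by exact_mod_cast n.succ_ne_zero
  simp only [kelvinStep, map_sub, map_mul, h1, eval_C, eval_X, zero_mul, zero_sub]
  exact neg_ne_zero.2 (mul_ne_zero h3 (mul_ne_zero h2 hP))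

theorem isHomogeneous_of_weight {P : Poly} {p q : ℕ} {k : ℤ}
    (hP : P.IsWeightedHomogeneous wt (p, q, k)) : P.IsHomogeneous (p + q) := by
  intro m hm
  have h := hP hm
  rw [weight_wt] at h
  simp only [Prod.mk.injEq] at h
  rw [Finsupp.weight_apply, Finsupp.sum_fintype _ _ (by simp)]
  simp
  omega

end

/-! ### Wirtinger calculus and the numerators of the derivatives -/

section

open MvPolynomial Topology

/-- The values of the variables at a point of `ℂ²`. -/
def coords (z : C2) : Var → ℂ := Sum.elim (fun j => z j) fun j => starRingEnd ℂ (z j)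

/-- The function on `ℂ²` given by a polynomial in `z, z̄`. -/
def evalConj : Poly →ₗ[ℂ] C2 → ℂ where
  toFun P z := eval (coords z) P
  map_add' P Q := by ext z; simp
  map_smul' c P := by ext z; simp

theorem evalConj_apply (P : Poly) (z : C2) : evalConj P z = eval (coords z) P := rfl

theorem evalConj_mul (P Q : Poly) : evalConj (P * Q) = evalConj P * evalConj Q := by
  ext z; simp [evalConj_apply]

theorem evalConj_normSqPoly (z : C2) : evalConj normSqPoly z = ((‖z‖ ^ 2 : ℝ) : ℂ) := by
  simp [evalConj_apply, normSqPoly, coords, EuclideanSpace.norm_sq_eq, Complex.mul_conj,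
    Complex.normSq_eq_norm_sq]

theorem evalConj_normSqPoly_ne_zero {z : C2} (hz : z ≠ 0) : evalConj normSqPoly z ≠ 0 := by
  rw [evalConj_normSqPoly]; simpa using hz

theorem contDiff_coords (s : Var) : ContDiff ℝ ∞ fun z => coords z s := by
  rcases s with j | j
  · have : ContDiff ℝ ∞ fun z : C2 => z j := by fun_prop
    exact this
  · have : ContDiff ℝ ∞ fun z : C2 => z j := by fun_prop
    exact Complex.conjCLE.contDiff.comp this

theorem contDiff_evalConj (P : Poly) : ContDiff ℝ ∞ (evalConj P) := by
  induction P using MvPolynomial.induction_on with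
  | C a =>
    have : evalConj (C a) = fun _ => a := by ext z; simp [evalConj_apply]
    rw [this]; exact contDiff_const
  | add P Q hP hQ => rw [map_add]; exact hP.add hQ
  | mul_X P s hP =>
    rw [evalConj_mul]
    have : evalConj (X s) = fun z => coords z s := by ext z; simp [evalConj_apply]
    exact hP.mul (this ▸ contDiff_coords s)

theorem differentiable_evalConj (P : Poly) : Differentiable ℝ (evalConj P) :=
  (contDiff_evalConj P).differentiable (by simp)

/-- The Wirtinger derivatives, indexed by the variables. -/
def wirtinger : Var → (C2 → ℂ) → C2 → ℂ := Sum.elim dz dzbar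

theorem wirtinger_congr (s : Var) {f g : C2 → ℂ} {z : C2} (h : f =ᶠ[𝓝 z] g) :
    wirtinger s f z = wirtinger s g z := by
  rcases s with j | j <;> simp [wirtinger, dz, dzbar, h.fderiv_eq]

theorem wirtinger_add (s : Var) {f g : C2 → ℂ} (hf : Differentiable ℝ f)
    (hg : Differentiable ℝ g) : wirtinger s (f + g) = wirtinger s f + wirtinger s g := by
  rcases s with j | j
  · exact dz_add j hf hg
  · exact dzbar_add j hf hg

theorem wirtinger_mul (s : Var) {f g : C2 → ℂ} {z : C2} (hf : DifferentiableAt ℝ f z)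
    (hg : DifferentiableAt ℝ g z) :
    wirtinger s (f * g) z = f z * wirtinger s g z + g z * wirtinger s f z := by
  rcases s with j | j <;> simp [wirtinger, dz, dzbar, fderiv_mul hf hg] <;> ring

theorem wirtinger_const (s : Var) (c : ℂ) : wirtinger s (fun _ => c) = 0 := by
  ext z
  rcases s with j | j <;> simp [wirtinger, dz, dzbar]

theorem fderiv_coord (j : Fin 2) (z v : C2) : fderiv ℝ (fun z : C2 => z j) z v = v j := by
  rw [show (fun z : C2 => z j) = ((EuclideanSpace.proj j : C2 →L[ℂ] ℂ).restrictScalars ℝ) from rfl,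
    ContinuousLinearMap.fderiv]
  rfl

theorem fderiv_conj_coord (j : Fin 2) (z v : C2) :
    fderiv ℝ (fun z : C2 => starRingEnd ℂ (z j)) z v = starRingEnd ℂ (v j) := by
  rw [show (fun z : C2 => starRingEnd ℂ (z j)) = (Complex.conjCLE.toContinuousLinearMap.comp
    ((EuclideanSpace.proj j : C2 →L[ℂ] ℂ).restrictScalars ℝ)) from rfl,
    ContinuousLinearMap.fderiv]
  rfl

theorem wirtinger_coords (s t : Var) (z : C2) :
    wirtinger s (fun z => coords z t) z = if t = s then 1 else 0 := by
  rcases s with j | j <;> rcases t with k | k <;>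
    simp only [wirtinger, coords, Sum.elim_inl, Sum.elim_inr, dz, dzbar, fderiv_coord,
      fderiv_conj_coord] <;>
    by_cases h : k = j <;>
    simp [h] <;> norm_num

theorem wirtinger_evalConj (s : Var) (P : Poly) :
    wirtinger s (evalConj P) = evalConj (pderiv s P) := by
  induction P using MvPolynomial.induction_on with
  | C a =>
    have : evalConj (C a) = fun _ => a := by ext z; simp [evalConj_apply]
    rw [this, wirtinger_const, pderiv_C, map_zero]
  | add P Q hP hQ =>
    rw [map_add, map_add, map_add, wirtinger_add s (differentiable_evalConj P)
      (differentiable_evalConj Q), hP, hQ]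
  | mul_X P t hP =>
    have : evalConj (X t) = fun z => coords z t := by ext z; simp [evalConj_apply]
    ext z
    rw [evalConj_mul, wirtinger_mul s (differentiable_evalConj P z)
      (differentiable_evalConj _ z), hP, this, wirtinger_coords, pderiv_mul, pderiv_X]
    by_cases h : t = s
    · subst h; simp [evalConj_apply]; ring
    · simp [evalConj_apply, h]; ring

theorem laplacian_evalConj (P : Poly) : laplacian (evalConj P) = evalConj (4 * lapPoly P) := by
  have h1 (j : Fin 2) (P : Poly) : dz j (evalConj P) = evalConj (pderiv (Sum.inl j) P) :=
    wirtinger_evalConj (Sum.inl j) P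
  have h2 (j : Fin 2) (P : Poly) : dzbar j (evalConj P) = evalConj (pderiv (Sum.inr j) P) :=
    wirtinger_evalConj (Sum.inr j) P
  ext z
  simp [laplacian, h1, h2, lapPoly, evalConj_apply]

/-- Formal partial derivatives correspond to Wirtinger derivatives of the function, so each
coefficient is reached by differentiating down to the constant term and evaluating at the origin. -/
theorem eq_zero_of_evalConj_eq_zero {P : Poly} (hP : evalConj P = 0) : P = 0 := by
  suffices h : ∀ n, ∀ (m : Var →₀ ℕ) (P : Poly), ∑ s, m s = n → evalConj P = 0 → coeff m P = 0 by
    ext m; simpa using h _ m P rfl hP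
  intro n
  induction n with
  | zero =>
    intro m P hm hP
    have h0 : m = 0 := by
      ext s; simpa using Finset.sum_eq_zero_iff.1 hm s (Finset.mem_univ s)
    have hc : coords 0 = 0 := by ext s; rcases s with j | j <;> simp [coords]
    have h := congrFun hP 0
    rw [evalConj_apply, hc, eval_zero] at h
    rw [h0]; exact h
  | succ n ih =>
    intro m P hm hP
    obtain ⟨s, -, hs⟩ := Finset.exists_ne_zero_of_sum_ne_zero (hm.trans_ne n.succ_ne_zero)
    have e : m - Finsupp.single s 1 + Finsupp.single s 1 = m :=
      tsub_add_cancel_of_le (Finsupp.single_le_iff.2 (Nat.one_le_iff_ne_zero.2 hs))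
    have h1 : ∑ t : Var, (m - Finsupp.single s 1 : Var →₀ ℕ) t = n := by
      have := congrArg (fun m : Var →₀ ℕ => ∑ t, m t) e
      simp only [Finsupp.add_apply, Finset.sum_add_distrib, hm, Finsupp.single_apply,
        Finset.sum_ite_eq, Finset.mem_univ, if_true] at this
      omega
    have h2 : evalConj (pderiv s P) = 0 := by
      rw [← wirtinger_evalConj, hP]; exact wirtinger_const s 0
    have h3 := ih _ _ h1 h2
    rw [coeff_pderiv, e, mul_eq_zero] at h3
    exact h3.resolve_right (Nat.cast_add_one_ne_zero _)

theorem wirtinger_div_pow (s : Var) (n : ℕ) (P : Poly) {z : C2} (hz : z ≠ 0) :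
    wirtinger s (fun z => evalConj P z / evalConj normSqPoly z ^ (n + 1)) z =
      evalConj (kelvinStep s n P) z / evalConj normSqPoly z ^ (n + 2) := by
  set g : C2 → ℂ := fun z => evalConj P z / evalConj normSqPoly z ^ (n + 1) with hg
  have hr := evalConj_normSqPoly_ne_zero hz
  have hd : DifferentiableAt ℝ g z := by
    have h1 : DifferentiableAt ℝ (fun z => evalConj normSqPoly z ^ (n + 1)) z :=
      (differentiable_evalConj normSqPoly z).fun_pow (n + 1)
    simp only [hg, div_eq_mul_inv]
    exact (differentiable_evalConj P z).fun_mul (h1.fun_inv (pow_ne_zero _ hr))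
  -- Clearing the denominator replaces the quotient rule by the product rule; the derivative of `g`
  -- is then solved for.
  have he : evalConj P =ᶠ[𝓝 z] g * evalConj (normSqPoly ^ (n + 1)) := by
    filter_upwards [isOpen_ne.mem_nhds hz] with w hw
    have := evalConj_normSqPoly_ne_zero hw
    have h2 : evalConj (normSqPoly ^ (n + 1)) w = evalConj normSqPoly w ^ (n + 1) := by
      simp [evalConj_apply]
    rw [Pi.mul_apply, h2, hg]
    field_simp
  have h := wirtinger_congr s he
  have hG : g z * evalConj normSqPoly z ^ (n + 1) = evalConj P z :=
    div_mul_cancel₀ _ (pow_ne_zero _ hr)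
  rw [wirtinger_mul s hd (differentiable_evalConj _ z), wirtinger_evalConj, wirtinger_evalConj,
    pderiv_pow, pderiv_normSqPoly] at h
  rw [eq_div_iff (pow_ne_zero _ hr)]
  clear_value g
  simp only [evalConj_apply, kelvinStep, map_sub, map_mul, map_pow, eval_C, eval_X, map_natCast,
    Nat.add_sub_cancel] at h hG ⊢
  push_cast at h
  linear_combination -eval (coords z) normSqPoly * h - (n + 1 : ℂ) * coords z s.swap * hG

/-- `P` is the numerator of `f`, a function obtained by applying `d s` times the derivative `∂_s`
for each variable `s` to `|z|⁻²`. -/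
structure IsNumerator (f : C2 → ℂ) (d : Var → ℕ) (P : Poly) : Prop where
  eq_div : ∀ z ≠ 0, f z = evalConj P z / evalConj normSqPoly z ^ (∑ s, d s + 1)
  lap : lapPoly P = 0
  weight : P.IsWeightedHomogeneous wt (∑ s, d s • wt s.swap)
  eval_ne : eval nullPoint P ≠ 0

theorem weight_of_multiplicities (d : Var → ℕ) : ∑ s, d s • wt s.swap =
    (((d (Sum.inr 0) + d (Sum.inr 1) : ℕ) : ℤ), ((d (Sum.inl 0) + d (Sum.inl 1) : ℕ) : ℤ),
      (d (Sum.inr 0) - d (Sum.inl 0) : ℤ)) := by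
  simp [wt, Prod.ext_iff, sub_eq_add_neg, add_comm]

theorem isNumerator_one : IsNumerator invNormSq 0 1 where
  eq_div z _ := by
    rw [evalConj_normSqPoly]
    simp [invNormSq, evalConj_apply]
  lap := by simp [lapPoly]
  weight := by simpa using isWeightedHomogeneous_one ℂ wt
  eval_ne := by simp

theorem IsNumerator.step {f : C2 → ℂ} {d : Var → ℕ} {P : Poly} (h : IsNumerator f d P)
    (s : Var) :
    IsNumerator (wirtinger s f) (d + Pi.single s 1) (kelvinStep s (∑ t, d t) P) where
  eq_div z hz := by
    have he : f =ᶠ[𝓝 z] fun z => evalConj P z / evalConj normSqPoly z ^ (∑ s, d s + 1) := by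
      filter_upwards [isOpen_ne.mem_nhds hz] with w hw using h.eq_div w hw
    rw [wirtinger_congr s he, wirtinger_div_pow s _ P hz]
    simp [Finset.sum_add_distrib]
  lap := by
    have hw := h.weight
    rw [weight_of_multiplicities] at hw
    have hn := isHomogeneous_of_weight hw
    -- The degree of the numerator equals the number of derivatives taken, which is the `n` for
    -- which `kelvinStep` preserves harmonicity.
    have e : d (Sum.inr 0) + d (Sum.inr 1) + (d (Sum.inl 0) + d (Sum.inl 1)) = ∑ t, d t := by
      simp [add_comm]
    exact lapPoly_kelvinStep (e ▸ hn) h.lap s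
  weight := by
    have e : ∑ t : Var, (d + Pi.single s 1 : Var → ℕ) t • wt t.swap = ∑ t, d t • wt t.swap + wt s.swap := by
      simp only [Pi.add_apply, add_smul, Finset.sum_add_distrib]
      rw [Finset.sum_eq_single s (f := fun t => (Pi.single s 1 : Var → ℕ) t • wt t.swap)]
      · simp
      · intro b _ hb; simp [hb]
      · simp
    rw [e]
    exact isWeightedHomogeneous_kelvinStep h.weight s _
  eval_ne := eval_nullPoint_kelvinStep h.eval_ne s _

theorem IsNumerator.iterate {f : C2 → ℂ} {d : Var → ℕ} {P : Poly} (h : IsNumerator f d P)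
    (s : Var) (k : ℕ) :
    ∃ Q, IsNumerator ((wirtinger s)^[k] f) (d + Pi.single s k) Q := by
  induction k with
  | zero => exact ⟨P, by simpa using h⟩
  | succ k ih =>
    obtain ⟨Q, hQ⟩ := ih
    have h' := hQ.step s
    rw [add_assoc, ← Pi.single_add, ← Function.iterate_succ_apply' (wirtinger s)] at h'
    exact ⟨_, h'⟩

theorem exists_isNumerator (α β : Fin 2 → ℕ) :
    ∃ P, IsNumerator (DbarPow α (DPow β invNormSq)) (Sum.elim β α) P := by
  obtain ⟨P1, h1⟩ := isNumerator_one.iterate (Sum.inl 1) (β 1)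
  obtain ⟨P2, h2⟩ := h1.iterate (Sum.inl 0) (β 0)
  obtain ⟨P3, h3⟩ := h2.iterate (Sum.inr 1) (α 1)
  obtain ⟨P4, h4⟩ := h3.iterate (Sum.inr 0) (α 0)
  refine ⟨P4, ?_⟩
  have e : (Sum.elim β α : Var → ℕ) = 0 + Pi.single (Sum.inl 1) (β 1) + Pi.single (Sum.inl 0) (β 0) +
      Pi.single (Sum.inr 1) (α 1) + Pi.single (Sum.inr 0) (α 0) := ?_
  · rw [e]; exact h4
  funext s
  rcases s with j | j <;> fin_cases j <;> simp

/-- A polynomial in `z, z̄` is homogeneous of bidegree `p, q`. -/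
def IsBihomogeneous (p q : ℕ) (P : Poly) : Prop :=
  ∀ m, coeff m P ≠ 0 →
    m (Sum.inl 0) + m (Sum.inl 1) = p ∧ m (Sum.inr 0) + m (Sum.inr 1) = q

theorem evalConj_monomial (m : Var →₀ ℕ) (c : ℂ) : evalConj (monomial m c) =
    c • monomialFun (fun j => m (Sum.inl j)) (fun j => m (Sum.inr j)) := by
  ext z
  simp [evalConj_apply, eval_monomial, Finsupp.prod_fintype, monomialFun, coords]

theorem IsBihomogeneous.evalConj_mem {p q : ℕ} {P : Poly} (hP : IsBihomogeneous p q P) :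
    evalConj P ∈ Ppq p q := by
  rw [P.as_sum, map_sum]
  refine Submodule.sum_mem _ fun m hm => ?_
  rw [evalConj_monomial]
  obtain ⟨h1, h2⟩ := hP m (mem_support_iff.1 hm)
  exact Submodule.smul_mem _ _ (Submodule.subset_span ⟨_, _, by simpa using h1, by simpa using h2,
    rfl⟩)

theorem exists_evalConj_eq {p q : ℕ} {f : C2 → ℂ} (hf : f ∈ Ppq p q) :
    ∃ P, IsBihomogeneous p q P ∧ evalConj P = f := by
  unfold Ppq at hf
  induction hf using Submodule.span_induction with
  | mem f h =>
    obtain ⟨α, β, hα, hβ, rfl⟩ := h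
    refine ⟨monomial (Finsupp.equivFunOnFinite.symm (Sum.elim α β)) 1, ?_, ?_⟩
    · intro m hm
      rw [coeff_monomial] at hm
      obtain rfl := (ite_ne_right_iff.1 hm).1
      simpa using And.intro hα hβ
    · rw [evalConj_monomial, one_smul]
      rfl
  | zero => exact ⟨0, by simp [IsBihomogeneous], by simp⟩
  | add f g _ _ hf hg =>
    obtain ⟨P, hP, rfl⟩ := hf
    obtain ⟨Q, hQ, rfl⟩ := hg
    refine ⟨P + Q, fun m hm => ?_, map_add _ _ _⟩
    rw [coeff_add] at hm
    by_cases h : coeff m P = 0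
    · exact hQ m fun h' => hm (by simp [h, h'])
    · exact hP m h
  | smul c f _ hf =>
    obtain ⟨P, hP, rfl⟩ := hf
    refine ⟨c • P, fun m hm => hP m fun h => hm (by simp [h]), map_smul _ _ _⟩

/-- Injectivity of `evalConj` lets harmonicity of the function pass back to the polynomial. -/
theorem mem_Hpq_iff {p q : ℕ} {f : C2 → ℂ} :
    f ∈ Hpq p q ↔ ∃ P, IsBihomogeneous p q P ∧ lapPoly P = 0 ∧ evalConj P = f := by
  constructor
  · rintro ⟨h1, h2⟩
    obtain ⟨P, hP, rfl⟩ := exists_evalConj_eq h1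
    rw [laplacian_evalConj] at h2
    exact ⟨P, hP, by simpa using eq_zero_of_evalConj_eq_zero h2, rfl⟩
  · rintro ⟨P, hP, hl, rfl⟩
    exact ⟨hP.evalConj_mem, by rw [laplacian_evalConj, hl, mul_zero, map_zero]⟩

theorem IsBihomogeneous.evalConj_smul {p q : ℕ} {P : Poly} (hP : IsBihomogeneous p q P) (t : ℝ)
    (z : C2) : evalConj P (t • z) = (t : ℂ) ^ (p + q) * evalConj P z := by
  rw [P.as_sum]
  simp only [map_sum, Finset.sum_apply, Finset.mul_sum]
  refine Finset.sum_congr rfl fun m hm => ?_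
  obtain ⟨rfl, rfl⟩ := hP m (mem_support_iff.1 hm)
  simp [evalConj_monomial, monomialFun]
  ring

end

/-! ### Rotation invariance of the surface measure -/

section

open MeasureTheory
open scoped Pointwise

/-- A linear isometry of `ℂ²` as a measurable self-equivalence of the unit sphere. -/
def sphereEquiv (U : C2 ≃ₗᵢ[ℝ] C2) : S3 ≃ᵐ S3 :=
  (Homeomorph.sets U.toHomeomorph (by ext z; simp) : S3 ≃ₜ S3).toMeasurableEquiv

theorem coe_sphereEquiv (U : C2 ≃ₗᵢ[ℝ] C2) (z : S3) : (sphereEquiv U z : C2) = U z := rfl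

/-- The surface measure is invariant under linear isometries. -/
theorem measurePreserving_sphereEquiv (U : C2 ≃ₗᵢ[ℝ] C2) :
    MeasurePreserving (sphereEquiv U) sigma sigma := by
  refine ⟨(sphereEquiv U).measurable, Measure.ext fun s hs => ?_⟩
  rw [Measure.map_apply (sphereEquiv U).measurable hs, sigma, Measure.toSphere_apply' _ hs,
    Measure.toSphere_apply' _ ((sphereEquiv U).measurable hs)]
  congr 1
  -- The surface measure is a dimensional constant times the volume of the cone over the set. The
  -- cone over the preimage is the preimage of the cone, and `U` preserves volume.
  rw [← U.measurePreserving.measure_preimage_emb U.toHomeomorph.measurableEmbedding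
    (Set.Ioo (0 : ℝ) 1 • (Subtype.val '' s))]
  congr 1
  ext z
  simp only [Set.mem_smul, Set.mem_image, Set.mem_preimage]
  constructor
  · rintro ⟨t, ht, -, ⟨x, hx, rfl⟩, rfl⟩
    exact ⟨t, ht, _, ⟨sphereEquiv U x, hx, rfl⟩, by simp [coe_sphereEquiv]⟩
  · rintro ⟨t, ht, -, ⟨x, hx, rfl⟩, h⟩
    refine ⟨t, ht, _, ⟨(sphereEquiv U).symm x, by simpa using hx, rfl⟩, U.injective ?_⟩
    rw [map_smul, ← coe_sphereEquiv, MeasurableEquiv.apply_symm_apply, h]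

/-- Multiplication of the first coordinate by a complex number of modulus one. -/
def rotate (u : Circle) : C2 ≃ₗᵢ[ℝ] C2 :=
  LinearIsometryEquiv.piLpCongrRight 2
    (Fin.cons (rotation u) fun _ => LinearIsometryEquiv.refl ℝ ℂ)

theorem rotate_apply_zero (u : Circle) (z : C2) : rotate u z 0 = u * z 0 := rfl

theorem rotate_apply_one (u : Circle) (z : C2) : rotate u z 1 = z 1 := rfl

/-- A function on the sphere with a nonzero weight under rotations of the first coordinate has
integral zero. -/
theorem integral_eq_zero_of_weight {k : ℤ} (hk : k ≠ 0) {g : S3 → ℂ}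
    (hg : ∀ (u : Circle) z, g (sphereEquiv (rotate u) z) = (u : ℂ) ^ k * g z) :
    ∫ z, g z ∂sigma = 0 := by
  -- Rotation by the angle `π / k` changes the sign of `g`, so the integral equals its own negative.
  have hu : ((Circle.exp (Real.pi / k) : Circle) : ℂ) ^ k = -1 := by
    rw [Circle.coe_exp, ← Complex.exp_int_mul]
    have : (k : ℂ) ≠ 0 := by exact_mod_cast hk
    rw [← Complex.exp_pi_mul_I]
    congr 1
    push_cast
    field_simp
  have h := (measurePreserving_sphereEquiv (rotate (Circle.exp (Real.pi / k)))).integral_comp' g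
  simp only [hg, hu, neg_mul, one_mul, integral_neg] at h
  linear_combination (-1 / 2 : ℂ) * h

end

/-! ### Basis, restriction to the sphere and orthogonality -/

section

open MvPolynomial MeasureTheory

theorem IsNumerator.eq_on_sphere {f : C2 → ℂ} {d : Var → ℕ} {P : Poly} (h : IsNumerator f d P)
    (z : S3) : f z = evalConj P z := by
  have hz : ‖(z : C2)‖ = 1 := by simp
  rw [h.eq_div z (by rintro h0; simp [h0] at hz), evalConj_normSqPoly, hz]
  simp

instance (p q : ℕ) : Finite (Index p q) := by
  refine ((Set.finite_Icc (0 : Fin 2 → ℕ) fun _ => p).prod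
    (Set.finite_Icc (0 : Fin 2 → ℕ) fun _ => q)).subset ?_
  rintro ⟨α, β⟩ ⟨hα, hβ, -⟩
  simp only [Fin.sum_univ_two] at hα hβ
  refine ⟨⟨zero_le, fun j => ?_⟩, zero_le, fun j => ?_⟩ <;> fin_cases j <;> simp <;> omega

/-- The polynomial extending the Kelvin transform of `D̄^α D^β |z|⁻²`. -/
def kelvinPoly {p q : ℕ} (i : Index p q) : Poly := (exists_isNumerator i.1.1 i.1.2).choose

/-- The exponent of the monomial `z^α z̄^β`. -/
def exponent {p q : ℕ} (i : Index p q) : Var →₀ ℕ :=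
  Finsupp.equivFunOnFinite.symm (Sum.elim i.1.1 i.1.2)

variable {p q : ℕ}

theorem isNumerator_kelvinPoly (i : Index p q) :
    IsNumerator (derivInvNormSq i) (Sum.elim i.1.2 i.1.1) (kelvinPoly i) :=
  (exists_isNumerator i.1.1 i.1.2).choose_spec

theorem exists_exponent_eq {m : Var →₀ ℕ} (hp : m (Sum.inl 0) + m (Sum.inl 1) = p)
    (hq : m (Sum.inr 0) + m (Sum.inr 1) = q) (h0 : m (Sum.inl 0) = 0 ∨ m (Sum.inr 0) = 0) :
    ∃ i : Index p q, exponent i = m := by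
  refine ⟨⟨(fun j => m (Sum.inl j), fun j => m (Sum.inr j)), by simpa using hp, by simpa using hq,
    h0⟩, ?_⟩
  ext s
  rcases s with j | j <;> simp [exponent]

theorem weight_of_coeff_kelvinPoly_ne_zero (i : Index p q) {m : Var →₀ ℕ}
    (hm : coeff m (kelvinPoly i) ≠ 0) :
    m (Sum.inl 0) + m (Sum.inl 1) = p ∧ m (Sum.inr 0) + m (Sum.inr 1) = q ∧
      (m (Sum.inl 0) - m (Sum.inr 0) : ℤ) = i.1.1 0 - i.1.2 0 := by
  have h := (isNumerator_kelvinPoly i).weight hm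
  have hα := i.2.1
  have hβ := i.2.2.1
  rw [weight_wt, weight_of_multiplicities] at h
  simp only [Prod.mk.injEq, Sum.elim_inl, Sum.elim_inr, Fin.sum_univ_two] at h hα hβ ⊢
  omega

theorem isBihomogeneous_kelvinPoly (i : Index p q) : IsBihomogeneous p q (kelvinPoly i) :=
  fun _ hm => ⟨(weight_of_coeff_kelvinPoly_ne_zero i hm).1,
    (weight_of_coeff_kelvinPoly_ne_zero i hm).2.1⟩

/-- An index is determined by its weight under rotations of the first coordinate. -/
theorem Index.ext_weight {i j : Index p q}
    (h : (i.1.1 0 - i.1.2 0 : ℤ) = j.1.1 0 - j.1.2 0) : i = j := by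
  obtain ⟨⟨α, β⟩, hα, hβ, h0⟩ := i
  obtain ⟨⟨γ, δ⟩, hγ, hδ, h1⟩ := j
  simp only [Fin.sum_univ_two] at h hα hβ h0 hγ hδ h1
  -- As one of `α_1`, `β_1` is zero, they are the positive and negative parts of `α_1 - β_1`; the
  -- totals `p` and `q` then fix `α_2` and `β_2`.
  refine Subtype.ext (Prod.ext (funext fun k => ?_) (funext fun k => ?_)) <;>
    fin_cases k <;> simp <;> omega

theorem eq_of_coeff_exponent_ne_zero {i j : Index p q}
    (h : coeff (exponent j) (kelvinPoly i) ≠ 0) : i = j :=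
  (Index.ext_weight (weight_of_coeff_kelvinPoly_ne_zero i h).2.2).symm

/-- This is the only determining coefficient that can be nonzero; were it zero, the polynomial would
vanish, contrary to its value at `nullPoint`. -/
theorem coeff_exponent_ne_zero (i : Index p q) : coeff (exponent i) (kelvinPoly i) ≠ 0 := by
  intro h
  refine (isNumerator_kelvinPoly i).eval_ne ?_
  rw [eq_zero_of_lapPoly_eq_zero (isNumerator_kelvinPoly i).lap, map_zero]
  intro m hm
  by_contra hc
  obtain ⟨hp, hq, -⟩ := weight_of_coeff_kelvinPoly_ne_zero i hc
  obtain ⟨j, rfl⟩ := exists_exponent_eq hp hq hm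
  obtain rfl := eq_of_coeff_exponent_ne_zero hc
  exact hc h

theorem coeff_exponent_sum [Fintype (Index p q)] (a : Index p q → ℂ) (j : Index p q) :
    coeff (exponent j) (∑ i, a i • kelvinPoly i) = a j * coeff (exponent j) (kelvinPoly j) := by
  rw [coeff_sum, Finset.sum_eq_single j]
  · simp
  · intro i _ hi
    rw [coeff_smul, not_not.1 (mt eq_of_coeff_exponent_ne_zero hi), smul_zero]
  · simp

theorem lapPoly_sum_smul [Fintype (Index p q)] (a : Index p q → ℂ) :
    lapPoly (∑ i, a i • kelvinPoly i) = 0 := by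
  have h (i : Index p q) := (isNumerator_kelvinPoly i).lap
  simp only [lapPoly] at h
  simp only [lapPoly, map_sum]
  rw [Finset.sum_comm]
  simp [← Finset.smul_sum, h]

theorem linearIndependent_kelvinPoly :
    LinearIndependent ℂ (kelvinPoly : Index p q → Poly) := by
  have := Fintype.ofFinite (Index p q)
  refine Fintype.linearIndependent_iff.2 fun a ha j => ?_
  have h := coeff_exponent_sum a j
  rw [ha, coeff_zero, eq_comm, mul_eq_zero] at h
  exact h.resolve_right (coeff_exponent_ne_zero j)

/-- Subtracting the combination with the same coefficients at the exponents of `Index p q` leaves a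
harmonic polynomial with no determining coefficients. -/
theorem mem_span_kelvinPoly {P : Poly} (hP : IsBihomogeneous p q P) (hl : lapPoly P = 0) :
    P ∈ Submodule.span ℂ (Set.range (kelvinPoly : Index p q → Poly)) := by
  have := Fintype.ofFinite (Index p q)
  set a : Index p q → ℂ := fun i => coeff (exponent i) P / coeff (exponent i) (kelvinPoly i)
  have h : P + (-1 : ℂ) • ∑ i, a i • kelvinPoly i = 0 := by
    refine eq_zero_of_lapPoly_eq_zero ?_ fun m hm => ?_
    · rw [lapPoly_add, lapPoly_smul, hl, lapPoly_sum_smul, smul_zero, add_zero]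
    · by_cases hw : m (Sum.inl 0) + m (Sum.inl 1) = p ∧ m (Sum.inr 0) + m (Sum.inr 1) = q
      · obtain ⟨j, rfl⟩ := exists_exponent_eq hw.1 hw.2 hm
        rw [coeff_add, coeff_smul, coeff_exponent_sum,
          div_mul_cancel₀ _ (coeff_exponent_ne_zero j)]
        simp
      · rw [coeff_add, coeff_smul, not_not.1 (mt (hP m) hw), coeff_sum, Finset.sum_eq_zero]
        · simp
        · intro i _
          rw [coeff_smul, not_not.1 (mt (isBihomogeneous_kelvinPoly i m) hw), smul_zero]
  rw [neg_one_smul, add_neg_eq_zero] at h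
  rw [h]
  exact Submodule.sum_mem _ fun i _ => Submodule.smul_mem _ _ (Submodule.subset_span ⟨i, rfl⟩)

theorem evalConj_injective : Function.Injective evalConj :=
  (injective_iff_map_eq_zero _).2 fun _ => eq_zero_of_evalConj_eq_zero

/-- The element of `H_{p,q}(ℂ²)` given by `kelvinPoly`. -/
def kelvinHarmonic (i : Index p q) : Hpq p q :=
  ⟨evalConj (kelvinPoly i), mem_Hpq_iff.2
    ⟨_, isBihomogeneous_kelvinPoly i, (isNumerator_kelvinPoly i).lap, rfl⟩⟩

/-- The basis of `H_{p,q}(ℂ²)` formed by the Kelvin transforms. -/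
def kelvinBasis (p q : ℕ) : Module.Basis (Index p q) ℂ (Hpq p q) :=
  Module.Basis.mk (v := kelvinHarmonic)
    (LinearIndependent.of_comp (Hpq p q).subtype
      (linearIndependent_kelvinPoly.map' evalConj (LinearMap.ker_eq_bot.2 evalConj_injective)))
    (by
      rintro ⟨f, hf⟩ -
      obtain ⟨P, hP, hl, rfl⟩ := mem_Hpq_iff.1 hf
      have h := Submodule.mem_map_of_mem (f := evalConj) (mem_span_kelvinPoly hP hl)
      rw [Submodule.map_span, ← Set.range_comp] at h
      have h' : evalConj P ∈
          (Submodule.span ℂ (Set.range (kelvinHarmonic (p := p) (q := q)))).map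
            (Hpq p q).subtype := by
        rw [Submodule.map_span, ← Set.range_comp]; exact h
      obtain ⟨y, hy, e⟩ := h'
      rwa [← show y = ⟨evalConj P, hf⟩ from Subtype.ext e])

theorem coe_kelvinBasis (i : Index p q) :
    (kelvinBasis p q i : C2 → ℂ) = evalConj (kelvinPoly i) := by
  rw [kelvinBasis, Module.Basis.mk_apply]
  rfl

/-- Since `z / |z|²` has norm `|z|⁻¹`, the powers cancel: `|z|⁻² · |z|^(-2(p+q)) · |z|^(2(p+q)+2) =
1`. -/
theorem kelvin_derivInvNormSq (i : Index p q) {z : C2} (hz : z ≠ 0) :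
    kelvin (derivInvNormSq i) z = evalConj (kelvinPoly i) z := by
  have hr : ((‖z‖ ^ 2)⁻¹ : ℝ) ≠ 0 := by simpa using hz
  have hr' : (‖z‖ : ℂ) ≠ 0 := by simpa using hz
  have hs : ∑ s, (Sum.elim i.1.2 i.1.1 : Var → ℕ) s = p + q := by
    obtain ⟨⟨α, β⟩, hα, hβ, -⟩ := i
    simp only [Fin.sum_univ_two] at hα hβ
    simp
    omega
  rw [kelvin, (isNumerator_kelvinPoly i).eq_div _ (smul_ne_zero hr hz), hs,
    (isBihomogeneous_kelvinPoly i).evalConj_smul, evalConj_normSqPoly, norm_smul]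
  have e : ((‖z‖ : ℂ) ^ 2)⁻¹ * ‖z‖ = (‖z‖ : ℂ)⁻¹ := by field_simp
  simp [e, inv_pow]
  field_simp
  ring

theorem kelvin_eq_on_sphere (g : C2 → ℂ) (z : S3) : kelvin g z = g z := by
  have hz : ‖(z : C2)‖ = 1 := by simp
  simp [kelvin, hz]

/-- Elements of `H_{p,q}(ℂ²)` are determined by their restrictions to the sphere. -/
theorem eq_zero_of_restrict_eq_zero {f : C2 → ℂ} (hf : f ∈ Hpq p q) (h0 : ∀ z : S3, f z = 0) :
    f = 0 := by
  obtain ⟨P, hP, -, rfl⟩ := mem_Hpq_iff.1 hf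
  have key (u : S3) (t : ℝ) : evalConj P (t • (u : C2)) = 0 := by
    rw [hP.evalConj_smul, h0, mul_zero]
  funext z
  -- The origin is reached by scaling a sphere point by `0`; this also covers `p = q = 0`, where the
  -- factor is `0 ^ 0 = 1`.
  by_cases hz : z = 0
  · have h := key ⟨EuclideanSpace.single 0 1, by simp⟩ 0
    rwa [zero_smul, ← hz] at h
  · have h := key ⟨(‖z‖⁻¹ : ℝ) • z, by simp [norm_smul, hz]⟩ ‖z‖
    rwa [smul_inv_smul₀ (norm_ne_zero_iff.2 hz)] at h

/-- Restriction to the sphere as a linear equivalence `H_{p,q}(ℂ²) ≃ H_{p,q}(𝕊³)`. -/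
def restrictEquiv (p q : ℕ) : Hpq p q ≃ₗ[ℂ] HpqS p q :=
  LinearEquiv.ofBijective ((LinearMap.funLeft ℂ ℂ (Subtype.val : S3 → C2)).submoduleMap (Hpq p q))
    ⟨(injective_iff_map_eq_zero _).2 fun f hf => Subtype.ext
      (eq_zero_of_restrict_eq_zero f.2 fun z => congrFun (congrArg Subtype.val hf) z),
      LinearMap.submoduleMap_surjective _ _⟩

theorem coe_restrictEquiv (f : Hpq p q) (z : S3) :
    (restrictEquiv p q f : S3 → ℂ) z = (f : C2 → ℂ) z := rfl

theorem evalConj_kelvinPoly_rotate (i : Index p q) (u : Circle) (z : C2) :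
    evalConj (kelvinPoly i) (rotate u z) =
      (u : ℂ) ^ (i.1.1 0 - i.1.2 0 : ℤ) * evalConj (kelvinPoly i) z := by
  rw [(kelvinPoly i).as_sum]
  simp only [map_sum, Finset.sum_apply, Finset.mul_sum]
  refine Finset.sum_congr rfl fun m hm => ?_
  have h := (weight_of_coeff_kelvinPoly_ne_zero i (mem_support_iff.1 hm)).2.2
  -- On the circle `u⁻¹` is the conjugate of `u`, so powers of `z̄_1` contribute negatively to the
  -- weight.
  rw [← h, zpow_sub₀ u.coe_ne_zero, zpow_natCast, zpow_natCast, div_eq_mul_inv, ← inv_pow,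
    ← Circle.coe_inv, Circle.coe_inv_eq_conj]
  simp [evalConj_monomial, monomialFun, rotate_apply_zero, rotate_apply_one]
  ring

/-- Conjugation negates the weight, so the integrand has the difference of the two weights, nonzero
by `Index.ext_weight`. -/
theorem integral_kelvinPoly_mul_conj {i j : Index p q} (hij : i ≠ j) :
    ∫ z : S3, evalConj (kelvinPoly i) z * starRingEnd ℂ (evalConj (kelvinPoly j) z) ∂sigma = 0 := by
  refine integral_eq_zero_of_weight
    (k := (i.1.1 0 - i.1.2 0 : ℤ) - (j.1.1 0 - j.1.2 0 : ℤ))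
    (fun h => hij (Index.ext_weight (sub_eq_zero.1 h))) fun u z => ?_
  rw [coe_sphereEquiv, evalConj_kelvinPoly_rotate, evalConj_kelvinPoly_rotate]
  generalize (i.1.1 0 - i.1.2 0 : ℤ) = a
  generalize (j.1.1 0 - j.1.2 0 : ℤ) = b
  rw [zpow_sub₀ u.coe_ne_zero, map_mul, map_zpow₀, ← Circle.coe_inv_eq_conj, Circle.coe_inv, inv_zpow]
  ring

instance : IsFiniteMeasure sigma := by unfold sigma; infer_instance

theorem memLp_evalConj (P : Poly) : MemLp (fun z : S3 => evalConj P z) 2 sigma := by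
  have hc : Continuous fun z : S3 => evalConj P z :=
    (contDiff_evalConj P).continuous.comp continuous_subtype_val
  exact hc.memLp_of_hasCompactSupport (HasCompactSupport.of_compactSpace _)

end

end SphericalHarmonics

end

theorem mainTheorem10 (p q : ℕ) :
    -- the functions `K[D̄^α D^β |z|⁻²]` (on `z ≠ 0`) are, after extension over the origin,
    -- a basis of `H_{p,q}(ℂ²)`
    (∃ b : Module.Basis (SphericalHarmonics.Index p q) ℂ (SphericalHarmonics.Hpq p q),
      ∀ (i : SphericalHarmonics.Index p q) (z : SphericalHarmonics.C2), z ≠ 0 →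
        (b i : SphericalHarmonics.C2 → ℂ) z
          = SphericalHarmonics.kelvin (SphericalHarmonics.derivInvNormSq i) z) ∧
    -- their restrictions to the sphere are the functions `D̄^α D^β |z|⁻²`
    (∀ (i : SphericalHarmonics.Index p q) (z : SphericalHarmonics.S3),
      SphericalHarmonics.kelvin (SphericalHarmonics.derivInvNormSq i) z
        = SphericalHarmonics.derivInvNormSq i z) ∧
    -- which form a basis of `H_{p,q}(𝕊³)`, orthogonal in `L²(𝕊³)`
    (∃ c : Module.Basis (SphericalHarmonics.Index p q) ℂ (SphericalHarmonics.HpqS p q),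
      (∀ (i : SphericalHarmonics.Index p q) (z : SphericalHarmonics.S3),
        (c i : SphericalHarmonics.S3 → ℂ) z = SphericalHarmonics.derivInvNormSq i z) ∧
      (∀ i : SphericalHarmonics.Index p q,
        MeasureTheory.MemLp (c i : SphericalHarmonics.S3 → ℂ) 2 SphericalHarmonics.sigma) ∧
      (∀ i j : SphericalHarmonics.Index p q, i ≠ j →
        ∫ z, (c i : SphericalHarmonics.S3 → ℂ) z
          * starRingEnd ℂ ((c j : SphericalHarmonics.S3 → ℂ) z) ∂SphericalHarmonics.sigma = 0)) := by
  refine ⟨⟨SphericalHarmonics.kelvinBasis p q, fun i z hz => ?_⟩, fun i z => ?_,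
    (SphericalHarmonics.kelvinBasis p q).map (SphericalHarmonics.restrictEquiv p q), fun i z => ?_,
    fun i => ?_, fun i j hij => ?_⟩
  · rw [SphericalHarmonics.coe_kelvinBasis, SphericalHarmonics.kelvin_derivInvNormSq i hz]
  · exact SphericalHarmonics.kelvin_eq_on_sphere _ z
  · rw [Module.Basis.map_apply, SphericalHarmonics.coe_restrictEquiv,
      SphericalHarmonics.coe_kelvinBasis,
      (SphericalHarmonics.isNumerator_kelvinPoly i).eq_on_sphere z]
  · convert SphericalHarmonics.memLp_evalConj (SphericalHarmonics.kelvinPoly i) using 1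
    funext z
    rw [Module.Basis.map_apply, SphericalHarmonics.coe_restrictEquiv,
      SphericalHarmonics.coe_kelvinBasis]
  · simp only [Module.Basis.map_apply, SphericalHarmonics.coe_restrictEquiv,
      SphericalHarmonics.coe_kelvinBasis]
    exact SphericalHarmonics.integral_kelvinPoly_mul_conj hij
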